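/- Let $\mathbb{F}_q$ be the finite field with $q$ elements, and let $B$ be a finite semi-simple $\mathbb{F}_q$-algebra with Artin–Wedderburn decomposition $$B \cong M_{d_1}(\mathbb{F}_{q^{n_1}})\times\cdots\times M_{d_k}(\mathbb{F}_{q^{n_k}}),\qquad d_i,n_i\ge 1,$$ of degree $n=\sum_{i=1}^k d_i^2 n_i\ge 2$, and put $m=\sum_{i=1}^k d_i n_i$. For $x\in B$ with components $x_i\in M_{d_i}(\mathbb{F}_{q^{n_i}})$ let $$\mathrm{Tr}_B(x)=\sum_{i=1}^k \mathrm{Tr}_{\mathbb{F}_{q^{n_i}}/\mathbb{F}_q}(\mathrm{tr}\,x_i),\qquad \mathrm{N}_B(x)=\prod_{i=1}^k \mathrm{N}_{\mathbb{F}_{q^{n_i}}/\mathbb{F}_q}(\det x_i)$$ be its (reduced) trace and norm, and for $a\in\mathbb{F}_q$, $b\in\mathbb{F}_q^*$ let $$\mathrm{N}_B(a,b)=\#\{x\in B^* : \mathrm{Tr}_B(x)=a,\ \mathrm{N}_B(x)=b\},$$ where $B^*$ is the group of invertible elements of $B$. In particular, for the split algebra $\mathbb{F}_q^m$ (all $d_i=n_i=1$),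 $\mathrm{N}_{\mathbb{F}_q^m}(a,b)$ is the number of $(y_1,\dots,y_m)\in(\mathbb{F}_q^*)^m$ with $y_1+\cdots+y_m=a$ and $y_1\cdots y_m=b$. Then for all $a\in\mathbb{F}_q$ and $b\in\mathbb{F}_q^*$, $$\mathrm{N}_B(a,b)-\left(\frac{|B^*|}{q(q-1)}+\frac{(-1)^{\sum_i d_i}q^{\frac{n-m}{2}}}{q}\right)=(-1)^{m-\sum_i d_i}\,q^{\frac{n-m}{2}}\left(\mathrm{N}_{\mathbb{F}_q^m}(a,b)-\frac{(q-1)^{m-1}+(-1)^m}{q}\right).$$ -/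

import Mathlib

namespace SemisimpleNormTrace

noncomputable section

variable {F : Type*} [Field F] {B : Type*} [Ring B] [Algebra F B]
  {k : ℕ} {d : Fin k → ℕ} {K : Fin k → Type*} [∀ i, Field (K i)] [∀ i, Algebra F (K i)]

/-- The (reduced) trace of `x ∈ B ≅ ∏ᵢ M_{dᵢ}(Kᵢ)`: the sum over `i` of
`Tr_{Kᵢ/F}(tr xᵢ)`, where `xᵢ` is the `i`-th matrix component of `x`. -/
def redTrace (e : B ≃ₐ[F] ((i : Fin k) → Matrix (Fin (d i)) (Fin (d i)) (K i))) (x : B) : F :=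
  ∑ i, Algebra.trace F (K i) (e x i).trace

/-- The (reduced) norm of `x ∈ B ≅ ∏ᵢ M_{dᵢ}(Kᵢ)`: the product over `i` of
`N_{Kᵢ/F}(det xᵢ)`, where `xᵢ` is the `i`-th matrix component of `x`. -/
def redNorm (e : B ≃ₐ[F] ((i : Fin k) → Matrix (Fin (d i)) (Fin (d i)) (K i))) (x : B) : F :=
  ∏ i, Algebra.norm F (e x i).det

/-- The number of invertible elements of `B` with trace `a` and norm `b`. -/
def normTraceCount (e : B ≃ₐ[F] ((i : Fin k) → Matrix (Fin (d i)) (Fin (d i)) (K i)))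
    (a b : F) : ℕ :=
  Nat.card {x : Bˣ // redTrace e (x : B) = a ∧ redNorm e (x : B) = b}

/-- The split étale algebra `F ^ m` as a product of `m` copies of `M₁(F)`. -/
def splitEquiv (F : Type*) [Field F] (m : ℕ) :
    (Fin m → F) ≃ₐ[F] ((_ : Fin m) → Matrix (Fin 1) (Fin 1) F) where
  toFun x i := Matrix.of fun _ _ => x i
  invFun y i := y i 0 0
  left_inv _ := rfl
  right_inv y := by
    ext i r s
    simp [Subsingleton.elim r 0, Subsingleton.elim s 0]
  map_mul' x y := by
    ext i r s
    simp [Matrix.mul_apply]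
  map_add' x y := by
    ext i r s
    simp
  commutes' c := by
    ext i r s
    simp [Matrix.algebraMap_matrix_apply, Subsingleton.elim r s]

end

end SemisimpleNormTrace

/-! Detect the condition Tr = a by the additive characters ψ of F. The trivial ψ contributes
|B^*|/(q-1), because the norm B^* → F^* is a surjective homomorphism. For nontrivial ψ, the sums of
ψ(Tr x) over N(x) = b, with b ≠ 0, are coefficients of a single Gauss sum ∑ χ(N x) ψ(Tr x) over B,
with values in the monoid algebra ℂ[F] and χ the tautological map `MonoidAlgebra.of`. This one
universal χ replaces all multiplicative characters.

Such a Gauss sum factors over the simple components of B. Over d × d matrices it equals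
|K|^{d(d-1)/2} G_K^d (`matrixGaussSum_fin`), and Hasse–Davenport gives G_K = (-1)^{[K:F]-1}
G_F^{[K:F]} (`sum_norm_trace_eq`). Hence the sum for B is (-1)^{m-∑dᵢ} q^{(n-m)/2} G_F^m, and G_F^m
is the sum for F^m (`sum_redNorm_redTrace`). Comparing coefficients at b and inverting over ψ gives
the identity. -/

namespace SemisimpleNormTrace

open Matrix

/-! ### Gauss sums over matrices -/

section GaussSum

variable {R : Type*} [CommRing R]

/-- A function on a finite additive group with vanishing sum still has vanishing sum after
pulling it back along a surjective homomorphism. -/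
theorem sum_comp_surjective_eq_zero [IsAddTorsionFree R] {G H : Type*} [AddCommGroup G]
    [AddCommGroup H] [Fintype G] [Fintype H] (L : G →+ H) (hL : Function.Surjective L)
    (f : H → R) (hf : ∑ h, f h = 0) : ∑ g, f (L g) = 0 := by
  -- Averaging over translates leaves only an integer to cancel. Torsion-freeness suffices for that,
  -- and the ring ℂ[F] used later has zero divisors.
  have key : Fintype.card H • ∑ g, f (L g) = 0 := by
    calc Fintype.card H • ∑ g, f (L g) = ∑ _h : H, ∑ g, f (L g) := by simp
      _ = ∑ h : H, ∑ g, f (L g + h) := by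
          refine Finset.sum_congr rfl fun h _ => ?_
          obtain ⟨g₀, rfl⟩ := hL h
          rw [← Equiv.sum_comp (Equiv.addRight g₀)]
          simp
      _ = ∑ g, ∑ h : H, f (L g + h) := Finset.sum_comm
      _ = 0 := by
          refine Finset.sum_eq_zero fun g _ => ?_
          rw [← hf, ← Equiv.sum_comp (Equiv.addLeft (L g)) f]
          simp
  refine nsmul_right_injective (n := Fintype.card H) Fintype.card_ne_zero ?_
  simpa using key

variable {K : Type*} [Field K] [Fintype K]

/-- The Gauss sum `∑ χ(det X) ψ(tr X)` over all square matrices `X`. -/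
noncomputable def matrixGaussSum (χ : K →* R) (ψ : AddChar K R) (ι : Type*) [Fintype ι]
    [DecidableEq ι] : R :=
  ∑ X : Matrix ι ι K, χ X.det * ψ X.trace

theorem matrixGaussSum_congr (χ : K →* R) (ψ : AddChar K R) {ι κ : Type*} [Fintype ι]
    [DecidableEq ι] [Fintype κ] [DecidableEq κ] (e : ι ≃ κ) :
    matrixGaussSum χ ψ ι = matrixGaussSum χ ψ κ := by
  refine Fintype.sum_equiv (Matrix.reindex e e) _ _ fun X => ?_
  have : (Matrix.reindex e e X).trace = X.trace := by
    simpa [Matrix.trace] using Equiv.sum_comp e.symm fun i => X i i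
  rw [Matrix.det_reindex_self, this]

variable [IsAddTorsionFree R]

/-- A nonzero row C makes V ↦ tr(CV) surjective onto K. -/
theorem sum_addChar_trace_mul {ψ : AddChar K R} (hψ : ∑ x, ψ x = 0) {ι : Type*} [Fintype ι]
    [DecidableEq ι] (C : Matrix (Fin 1) ι K) (hC : C ≠ 0) :
    ∑ V : Matrix ι (Fin 1) K, ψ (C * V).trace = 0 := by
  obtain ⟨j, hj⟩ : ∃ j, C 0 j ≠ 0 := by
    by_contra! h
    exact hC (by ext i j; rw [Subsingleton.elim i 0, h j]; rfl)
  refine sum_comp_surjective_eq_zero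
    (⟨⟨fun V : Matrix ι (Fin 1) K => (C * V).trace, by simp⟩,
      fun V W => by simp [Matrix.mul_add]⟩ : Matrix ι (Fin 1) K →+ K) (fun z => ?_) ψ hψ
  refine ⟨Matrix.of fun i _ => if i = j then (C 0 j)⁻¹ * z else 0, ?_⟩
  simp [Matrix.trace, Matrix.mul_apply, hj]

/-- Only the matrices whose last row vanishes off the diagonal contribute. -/
theorem matrixGaussSum_sum_fin_one (χ : K →* R) {ψ : AddChar K R} (hψ : ∑ x, ψ x = 0)
    (ι : Type*) [Fintype ι] [DecidableEq ι] :
    matrixGaussSum χ ψ (ι ⊕ Fin 1) =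
      (Fintype.card K : R) ^ Fintype.card ι * matrixGaussSum χ ψ ι * ∑ y, χ y * ψ y := by
  classical
  let e : (Matrix ι ι K × Matrix ι (Fin 1) K) × (Matrix (Fin 1) ι K × K) ≃
      Matrix (ι ⊕ Fin 1) (ι ⊕ Fin 1) K :=
    { toFun := fun p => fromBlocks p.1.1 p.1.2 p.2.1 (of fun _ _ => p.2.2)
      invFun := fun X => ((X.toBlocks₁₁, X.toBlocks₁₂), (X.toBlocks₂₁, X.toBlocks₂₂ 0 0))
      left_inv := fun p => by simp
      right_inv := fun X => by
        conv_rhs => rw [← fromBlocks_toBlocks X]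
        have hD : (of fun _ _ => X.toBlocks₂₂ 0 0) = X.toBlocks₂₂ := by
          ext i j
          rw [Subsingleton.elim i 0, Subsingleton.elim j 0, of_apply]
        dsimp only
        rw [hD] }
  have htr (A : Matrix ι ι K) (B C) (D : Matrix (Fin 1) (Fin 1) K) :
      (fromBlocks A B C D).trace = A.trace + D.trace := by
    simp [Matrix.trace, Fintype.sum_sum_type]
  let h : Matrix (ι ⊕ Fin 1) (ι ⊕ Fin 1) K → R := fun X => χ X.det * ψ X.trace
  let N := Fintype.card (Matrix ι (Fin 1) K)
  -- Right multiplication by a unipotent block matrix fixes the determinant and adds tr(CV) to the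
  -- trace, C being the lower left block.
  have htranslate (V : Matrix ι (Fin 1) K) :
      ∑ X, h X = ∑ X, h X * ψ (X.toBlocks₂₁ * V).trace := by
    have hdet : (fromBlocks 1 V 0 1 : Matrix (ι ⊕ Fin 1) (ι ⊕ Fin 1) K).det = 1 := by simp
    have hinv := Matrix.mul_nonsing_inv (fromBlocks 1 V 0 1) (by rw [hdet]; exact isUnit_one)
    have hinv' := Matrix.nonsing_inv_mul (fromBlocks 1 V 0 1) (by rw [hdet]; exact isUnit_one)
    let t : Matrix (ι ⊕ Fin 1) (ι ⊕ Fin 1) K ≃ Matrix (ι ⊕ Fin 1) (ι ⊕ Fin 1) K :=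
      { toFun := fun X => X * fromBlocks 1 V 0 1
        invFun := fun X => X * (fromBlocks 1 V 0 1)⁻¹
        left_inv := fun X => by simp only [Matrix.mul_assoc, hinv, Matrix.mul_one]
        right_inv := fun X => by simp only [Matrix.mul_assoc, hinv', Matrix.mul_one] }
    rw [← Equiv.sum_comp t h]
    refine Finset.sum_congr rfl fun X _ => ?_
    have ht : (t X).trace = X.trace + (X.toBlocks₂₁ * V).trace := by
      change (X * fromBlocks 1 V 0 1).trace = _
      conv_lhs => rw [← fromBlocks_toBlocks X, fromBlocks_multiply, htr]
      conv_rhs => rw [← fromBlocks_toBlocks X, htr]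
      simp [Matrix.trace_add]
      ring
    change χ (X * fromBlocks 1 V 0 1).det * ψ (t X).trace = _
    rw [Matrix.det_mul, hdet, mul_one, ht, AddChar.map_add_eq_mul, mul_assoc]
  -- Averaging over V kills every X with C ≠ 0.
  have hcut : ∑ X, h X = ∑ X, if X.toBlocks₂₁ = 0 then h X else 0 := by
    refine nsmul_right_injective (n := N) Fintype.card_ne_zero ?_
    change N • _ = N • _
    calc N • ∑ X, h X = ∑ V : Matrix ι (Fin 1) K, ∑ X, h X * ψ (X.toBlocks₂₁ * V).trace := by
          rw [← Finset.sum_congr rfl fun V _ => htranslate V]; simp [N]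
      _ = ∑ X, h X * ∑ V : Matrix ι (Fin 1) K, ψ (X.toBlocks₂₁ * V).trace := by
          rw [Finset.sum_comm]; simp_rw [Finset.mul_sum]
      _ = N • ∑ X, if X.toBlocks₂₁ = 0 then h X else 0 := by
          rw [Finset.smul_sum]
          refine Finset.sum_congr rfl fun X _ => ?_
          split_ifs with hX
          · simp [hX, N, mul_comm]
          · rw [sum_addChar_trace_mul hψ _ hX]; simp
  change ∑ X, h X = _
  rw [hcut, ← Equiv.sum_comp e, Fintype.sum_prod_type, Fintype.sum_prod_type]
  have hval (A : Matrix ι ι K) (b : Matrix ι (Fin 1) K) :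
      (∑ p : Matrix (Fin 1) ι K × K, if (e ((A, b), p)).toBlocks₂₁ = 0 then h (e ((A, b), p)) else 0)
        = (χ A.det * ψ A.trace) * ∑ y, χ y * ψ y := by
    rw [Fintype.sum_prod_type, Finset.sum_eq_single 0]
    · rw [Finset.mul_sum]
      refine Finset.sum_congr rfl fun y _ => ?_
      have h1 : (of fun _ _ => y : Matrix (Fin 1) (Fin 1) K).det = y := by simp
      have h2 : (of fun _ _ => y : Matrix (Fin 1) (Fin 1) K).trace = y := by simp [Matrix.trace]
      simp only [e, h, Equiv.coe_fn_mk, toBlocks_fromBlocks₂₁, if_true, det_fromBlocks_zero₂₁, htr,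
        h1, h2, map_mul, AddChar.map_add_eq_mul]
      ring
    · intro C _ hC
      exact Finset.sum_eq_zero fun y _ => by simp [e, hC]
    · simp
  simp_rw [hval]
  simp only [Finset.sum_const, matrixGaussSum, Finset.mul_sum, Finset.sum_mul, nsmul_eq_mul]
  have hcard : Fintype.card (Matrix ι (Fin 1) K) = Fintype.card K ^ Fintype.card ι := by
    rw [← Nat.card_eq_fintype_card, Matrix, Nat.card_fun, Nat.card_fun]
    simp
  simp only [Finset.card_univ, hcard, Nat.cast_pow]
  rw [Finset.sum_comm]
  simp only [mul_assoc]

/-- The Gauss sum over `d × d` matrices in terms of the Gauss sum over the field. -/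
theorem matrixGaussSum_fin (χ : K →* R) {ψ : AddChar K R} (hψ : ∑ x, ψ x = 0) (d : ℕ) :
    matrixGaussSum χ ψ (Fin d) =
      (Fintype.card K : R) ^ (d * (d - 1) / 2) * (∑ y, χ y * ψ y) ^ d := by
  induction d with
  | zero =>
    have : Fintype.card (Matrix (Fin 0) (Fin 0) K) = 1 :=
      Fintype.card_eq_one_iff.2 ⟨0, fun _ => Subsingleton.elim _ _⟩
    simp [matrixGaussSum, Matrix.trace, this]
  | succ d ih =>
    rw [← matrixGaussSum_congr χ ψ (finSumFinEquiv (m := d) (n := 1)),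
      matrixGaussSum_sum_fin_one χ hψ, ih]
    have : (d + 1) * (d + 1 - 1) / 2 = d + d * (d - 1) / 2 := by
      rw [← Finset.sum_range_id_mul_two, ← Finset.sum_range_id_mul_two, Finset.sum_range_succ]
      simp [add_comm]
    rw [this, pow_add, pow_succ, Fintype.card_fin]
    ring

end GaussSum

end SemisimpleNormTrace

namespace SemisimpleNormTrace

open Polynomial

/-! ### Monic polynomials and prime powers over a finite field -/

section MonicPolynomials

variable (F : Type*) [Field F] [Fintype F]

theorem finite_monic_natDegree_eq (n : ℕ) :
    {f : F[X] | f.Monic ∧ f.natDegree = n}.Finite :=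
  Finite.of_equiv (Fin n → F)
    ((monicEquivDegreeLT n).trans (degreeLTEquiv F n).toEquiv).symm

/-- The monic polynomials of degree `n` over a finite field. -/
noncomputable def monicsOfDegree (n : ℕ) : Finset F[X] := (finite_monic_natDegree_eq F n).toFinset

variable {F}

@[simp]
theorem mem_monicsOfDegree {n : ℕ} {f : F[X]} :
    f ∈ monicsOfDegree F n ↔ f.Monic ∧ f.natDegree = n := by
  simp [monicsOfDegree]

open scoped Classical in
variable (F) in
/-- The pairs `(P, k)` where `P` is monic irreducible, `1 ≤ deg P ≤ N` and `1 ≤ k ≤ N`. -/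
noncomputable def primePowersUpTo (N : ℕ) : Finset (F[X] × ℕ) :=
  (((Finset.range (N + 1)).biUnion (monicsOfDegree F)).filter Irreducible) ×ˢ Finset.Icc 1 N

theorem mem_primePowersUpTo {N : ℕ} {x : F[X] × ℕ} : x ∈ primePowersUpTo F N ↔
    (x.1.Monic ∧ x.1.natDegree ≤ N ∧ Irreducible x.1) ∧ 1 ≤ x.2 ∧ x.2 ≤ N := by
  simp only [primePowersUpTo, Finset.mem_product, Finset.mem_filter, Finset.mem_biUnion,
    Finset.mem_range, mem_monicsOfDegree, Finset.mem_Icc]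
  constructor
  · rintro ⟨⟨⟨a, ha, h1, h2⟩, h3⟩, h4⟩
    exact ⟨⟨h1, by omega, h3⟩, h4⟩
  · rintro ⟨⟨h1, h2, h3⟩, h4⟩
    exact ⟨⟨⟨_, by omega, h1, rfl⟩, h3⟩, h4⟩

variable (F) in
/-- The pairs `(P, k)` where `P` is monic irreducible, `1 ≤ k` and `P ^ k` has degree `n`. -/
noncomputable def primePowersOfDegree (n : ℕ) : Finset (F[X] × ℕ) :=
  (primePowersUpTo F n).filter fun x => x.2 * x.1.natDegree = n

theorem mem_primePowersOfDegree {n : ℕ} {x : F[X] × ℕ} : x ∈ primePowersOfDegree F n ↔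
    x.1.Monic ∧ Irreducible x.1 ∧ 1 ≤ x.2 ∧ x.2 * x.1.natDegree = n := by
  simp only [primePowersOfDegree, Finset.mem_filter, mem_primePowersUpTo]
  constructor
  · tauto
  · rintro ⟨h1, h2, h3, h4⟩
    have := h2.natDegree_pos
    exact ⟨⟨⟨h1, by nlinarith, h2⟩, h3, by nlinarith⟩, h4⟩

/-- Lets prime powers of different degrees be summed over one common index set. -/
theorem primePowersUpTo_filter_eq {N n : ℕ} (h : n ≤ N) :
    (primePowersUpTo F N).filter (fun x => x.2 * x.1.natDegree = n) = primePowersOfDegree F n := by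
  ext x
  simp only [mem_primePowersOfDegree, Finset.mem_filter, mem_primePowersUpTo]
  constructor
  · tauto
  · rintro ⟨h1, h2, h3, h4⟩
    have := h2.natDegree_pos
    exact ⟨⟨⟨h1, by nlinarith, h2⟩, h3, by nlinarith⟩, h4⟩

open scoped Classical in
/-- The degree of a polynomial is the sum of the degrees of the primes `P` over all prime powers
`P ^ k` dividing it. -/
theorem sum_natDegree_primePowers_dvd {n : ℕ} {f : F[X]} (hf : f ∈ monicsOfDegree F n) :
    ∑ x ∈ primePowersUpTo F n, (if x.1 ^ x.2 ∣ f then x.1.natDegree else 0) = n := by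
  obtain ⟨hm, hn⟩ := mem_monicsOfDegree.1 hf
  set s := UniqueFactorizationMonoid.normalizedFactors f with hs
  have hmem {P : F[X]} (hP : P ∈ s) : P.Monic ∧ P.natDegree ≤ n ∧ Irreducible P := by
    have h0 := UniqueFactorizationMonoid.irreducible_of_normalized_factor P hP
    have h1 := UniqueFactorizationMonoid.dvd_of_mem_normalizedFactors hP
    have h2 := UniqueFactorizationMonoid.normalize_normalized_factor P hP
    exact ⟨h2 ▸ monic_normalize h0.ne_zero, hn ▸ natDegree_le_of_dvd h1 hm.ne_zero, h0⟩
  have hprod : s.prod = f := by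
    have h1 := UniqueFactorizationMonoid.prod_normalizedFactors hm.ne_zero
    refine eq_of_monic_of_associated ?_ hm h1
    simpa using monic_multiset_prod_of_monic s id fun P hP => (hmem hP).1
  have hdeg : n = ∑ P ∈ s.toFinset, s.count P * P.natDegree := by
    rw [← hn, ← hprod, natDegree_multiset_prod_of_monic _ fun P hP => (hmem hP).1,
      Finset.sum_multiset_map_count]
    rfl
  -- Thus P is counted once for each k up to its multiplicity in f.
  have hcount {P : F[X]} (hP : P.Monic) (hi : Irreducible P) (k : ℕ) :
      P ^ k ∣ f ↔ k ≤ s.count P := by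
    rw [pow_dvd_iff_le_emultiplicity,
      UniqueFactorizationMonoid.le_emultiplicity_iff_replicate_le_normalizedFactors hi hm.ne_zero,
      hP.normalize_eq_self, ← hs, Multiset.le_count_iff_replicate_le]
  rw [primePowersUpTo, Finset.sum_product]
  conv_rhs => rw [hdeg]
  symm
  have hsub : s.toFinset ⊆
      ((Finset.range (n + 1)).biUnion (monicsOfDegree F)).filter Irreducible := by
    intro P hP
    obtain ⟨h1, h2, h3⟩ := hmem (Multiset.mem_toFinset.1 hP)
    simp only [Finset.mem_filter, Finset.mem_biUnion, Finset.mem_range, mem_monicsOfDegree]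
    exact ⟨⟨_, by omega, h1, rfl⟩, h3⟩
  rw [Finset.sum_subset hsub]
  · refine Finset.sum_congr rfl fun P hP => ?_
    simp only [Finset.mem_filter, Finset.mem_biUnion, Finset.mem_range, mem_monicsOfDegree] at hP
    obtain ⟨⟨_, _, h1, _⟩, h3⟩ := hP
    have hle : s.count P ≤ n := by
      have h4 := natDegree_le_of_dvd ((hcount h1 h3 _).2 le_rfl) hm.ne_zero
      rw [natDegree_pow, hn] at h4
      have := h3.natDegree_pos
      nlinarith
    simp only [hcount h1 h3]
    rw [← Finset.sum_filter, Finset.sum_const]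
    have : (Finset.Icc 1 n).filter (fun k => k ≤ s.count P) = Finset.Icc 1 (s.count P) := by
      ext k
      simp only [Finset.mem_filter, Finset.mem_Icc]
      omega
    rw [this]
    simp
  · intro P _ hP
    rw [Multiset.mem_toFinset] at hP
    simp [Multiset.count_eq_zero_of_notMem hP]

end MonicPolynomials

/-! ### The L-series of the weight and its logarithmic derivative -/

section Weight

variable {F : Type*} [Field F] {R : Type*} [CommRing R] (χ : F →* R) (ψ : AddChar F R)

/-- The completely multiplicative weight `χ(N f) ψ(Tr f)` of a monic polynomial, where `N f` and
`Tr f` are the product and the sum of its roots. -/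
noncomputable def polyWeight (f : F[X]) : R :=
  χ ((-1) ^ f.natDegree * f.coeff 0) * ψ (-f.nextCoeff)

theorem polyWeight_one : polyWeight χ ψ 1 = 1 := by
  simp [polyWeight, nextCoeff]

theorem polyWeight_mul {f g : F[X]} (hf : f.Monic) (hg : g.Monic) :
    polyWeight χ ψ (f * g) = polyWeight χ ψ f * polyWeight χ ψ g := by
  rw [polyWeight, hf.natDegree_mul hg, mul_coeff_zero, hf.nextCoeff_mul hg, neg_add,
    AddChar.map_add_eq_mul, pow_add, mul_mul_mul_comm, map_mul, polyWeight, polyWeight]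
  ring

theorem polyWeight_pow {f : F[X]} (hf : f.Monic) (k : ℕ) :
    polyWeight χ ψ (f ^ k) = polyWeight χ ψ f ^ k := by
  induction k with
  | zero => simp [polyWeight_one]
  | succ k ih => rw [pow_succ, polyWeight_mul χ ψ (hf.pow k) hf, ih, pow_succ]

variable [Fintype F]

theorem sum_monicsOfDegree_zero : ∑ f ∈ monicsOfDegree F 0, polyWeight χ ψ f = 1 := by
  have : monicsOfDegree F 0 = {1} := by
    ext f
    simp only [mem_monicsOfDegree, Finset.mem_singleton]
    exact ⟨fun h => eq_one_of_monic_natDegree_zero h.1 h.2, fun h => by simp [h]⟩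
  rw [this, Finset.sum_singleton, polyWeight_one]

theorem sum_monicsOfDegree_one :
    ∑ f ∈ monicsOfDegree F 1, polyWeight χ ψ f = ∑ y, χ y * ψ y := by
  symm
  refine Finset.sum_bij (fun a _ => X - C a) ?_ ?_ ?_ ?_
  · intro a _
    simp [monic_X_sub_C]
  · intro a _ b _ h
    simpa using h
  · intro f hf
    obtain ⟨h1, h2⟩ := mem_monicsOfDegree.1 hf
    refine ⟨-f.coeff 0, Finset.mem_univ _, ?_⟩
    rw [h1.eq_X_add_C h2]
    simp
  · intro a _
    simp [polyWeight, nextCoeff_X_sub_C]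

/-- For n ≥ 2 the coefficient of X^(n-1) is not the constant one, so adding c X^(n-1) only
multiplies the weight by ψ(-c); average over c. The L-series is therefore the polynomial 1 + G T. -/
theorem sum_monicsOfDegree_of_two_le [IsAddTorsionFree R] (hψ : ∑ x, ψ x = 0) {n : ℕ}
    (hn : 2 ≤ n) : ∑ f ∈ monicsOfDegree F n, polyWeight χ ψ f = 0 := by
  have hlt (c : F) : (C c * X ^ (n - 1)).degree < (n : WithBot ℕ) :=
    (degree_C_mul_X_pow_le _ _).trans_lt (by exact_mod_cast (by omega : n - 1 < n))
  have hmem {f : F[X]} (hf : f ∈ monicsOfDegree F n) (c : F) :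
      f + C c * X ^ (n - 1) ∈ monicsOfDegree F n := by
    obtain ⟨h1, h2⟩ := mem_monicsOfDegree.1 hf
    have h3 : (C c * X ^ (n - 1)).degree < f.degree := by
      rw [degree_eq_natDegree h1.ne_zero, h2]; exact hlt c
    exact mem_monicsOfDegree.2 ⟨h1.add_of_left h3, by
      rw [natDegree_add_eq_left_of_degree_lt h3, h2]⟩
  have htranslate (c : F) : ∑ f ∈ monicsOfDegree F n, polyWeight χ ψ f =
      ∑ f ∈ monicsOfDegree F n, polyWeight χ ψ f * ψ (-c) := by
    symm
    refine Finset.sum_bij (fun f _ => f + C c * X ^ (n - 1)) (fun f hf => hmem hf c) ?_ ?_ ?_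
    · intro f _ g _ h
      simpa using h
    · intro f hf
      exact ⟨f + C (-c) * X ^ (n - 1), hmem hf _, by simp⟩
    · intro f hf
      obtain ⟨h1, h2⟩ := mem_monicsOfDegree.1 hf
      obtain ⟨h3, h4⟩ := mem_monicsOfDegree.1 (hmem hf c)
      have h5 : (f + C c * X ^ (n - 1)).nextCoeff = f.nextCoeff + c := by
        rw [nextCoeff_of_natDegree_pos (by omega), nextCoeff_of_natDegree_pos (by omega), h4, h2]
        simp
      have h6 : (0 : ℕ) ≠ n - 1 := by omega
      rw [polyWeight, polyWeight, h2, h4, h5, neg_add, AddChar.map_add_eq_mul]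
      simp [coeff_X_pow, h6, mul_assoc]
  refine nsmul_right_injective (n := Fintype.card F) Fintype.card_ne_zero ?_
  change Fintype.card F • _ = Fintype.card F • _
  calc Fintype.card F • ∑ f ∈ monicsOfDegree F n, polyWeight χ ψ f
      = ∑ c : F, ∑ f ∈ monicsOfDegree F n, polyWeight χ ψ f * ψ (-c) := by
        rw [← Finset.sum_congr rfl fun c _ => htranslate c]; simp
    _ = ∑ f ∈ monicsOfDegree F n, polyWeight χ ψ f * ∑ c : F, ψ (-c) := by
        rw [Finset.sum_comm]; simp_rw [Finset.mul_sum]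
    _ = Fintype.card F • 0 := by
        have : ∑ c : F, ψ (-c) = 0 := by rw [← hψ]; exact Equiv.sum_comp (Equiv.neg F) ψ
        simp [this]

open scoped Classical in
theorem sum_monicsOfDegree_filter_dvd {P : F[X]} (hP : P.Monic) (n k : ℕ) :
    ∑ f ∈ monicsOfDegree F n with P ^ k ∣ f, polyWeight χ ψ f =
      if k * P.natDegree ≤ n then polyWeight χ ψ P ^ k *
        ∑ f ∈ monicsOfDegree F (n - k * P.natDegree), polyWeight χ ψ f else 0 := by
  split_ifs with h
  · rw [Finset.mul_sum]
    symm
    refine Finset.sum_bij (fun f _ => P ^ k * f) ?_ ?_ ?_ ?_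
    · intro f hf
      obtain ⟨h1, h2⟩ := mem_monicsOfDegree.1 hf
      simp only [Finset.mem_filter, mem_monicsOfDegree, dvd_mul_right, and_true]
      refine ⟨(hP.pow k).mul h1, ?_⟩
      rw [(hP.pow k).natDegree_mul h1, hP.natDegree_pow, h2]
      omega
    · intro f _ g _ hfg
      exact mul_left_cancel₀ (hP.pow k).ne_zero hfg
    · intro f hf
      simp only [Finset.mem_filter, mem_monicsOfDegree] at hf
      obtain ⟨⟨h1, h2⟩, g, rfl⟩ := hf
      have hg : g.Monic := (hP.pow k).of_mul_monic_left h1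
      refine ⟨g, mem_monicsOfDegree.2 ⟨hg, ?_⟩, rfl⟩
      rw [(hP.pow k).natDegree_mul hg, hP.natDegree_pow] at h2
      omega
    · intro f hf
      rw [polyWeight_mul χ ψ (hP.pow k) (mem_monicsOfDegree.1 hf).1, polyWeight_pow χ ψ hP]
  · refine Finset.sum_eq_zero fun f hf => ?_
    simp only [Finset.mem_filter, mem_monicsOfDegree] at hf
    have := natDegree_le_of_dvd hf.2 hf.1.1.ne_zero
    rw [hP.natDegree_pow, hf.1.2] at this
    omega

/-- The `n`-th coefficient of the logarithmic derivative of the Euler product attached to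
`polyWeight χ ψ`. -/
noncomputable def primePowerSum (n : ℕ) : R :=
  ∑ x ∈ primePowersOfDegree F n, (x.1.natDegree : R) * polyWeight χ ψ x.1 ^ x.2

/-- The coefficients of a logarithmic derivative, multiplied out. -/
theorem natCast_mul_sum_monicsOfDegree (n : ℕ) :
    (n : R) * ∑ f ∈ monicsOfDegree F n, polyWeight χ ψ f =
      ∑ x ∈ primePowersUpTo F n, if x.2 * x.1.natDegree ≤ n then
        (x.1.natDegree : R) * polyWeight χ ψ x.1 ^ x.2 *
          ∑ f ∈ monicsOfDegree F (n - x.2 * x.1.natDegree), polyWeight χ ψ f else 0 := by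
  classical
  calc (n : R) * ∑ f ∈ monicsOfDegree F n, polyWeight χ ψ f
      -- Here n = deg f is written as the sum of deg P over all P^k dividing f.
      = ∑ f ∈ monicsOfDegree F n, ∑ x ∈ primePowersUpTo F n,
          if x.1 ^ x.2 ∣ f then (x.1.natDegree : R) * polyWeight χ ψ f else 0 := by
        rw [Finset.mul_sum]
        refine Finset.sum_congr rfl fun f hf => ?_
        conv_lhs => rw [← sum_natDegree_primePowers_dvd hf]
        rw [Nat.cast_sum, Finset.sum_mul]
        refine Finset.sum_congr rfl fun x _ => ?_
        split_ifs <;> simp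
    _ = ∑ x ∈ primePowersUpTo F n, (x.1.natDegree : R) *
          ∑ f ∈ monicsOfDegree F n with x.1 ^ x.2 ∣ f, polyWeight χ ψ f := by
        rw [Finset.sum_comm]
        refine Finset.sum_congr rfl fun x _ => ?_
        rw [Finset.mul_sum, Finset.sum_filter]
    _ = _ := by
        refine Finset.sum_congr rfl fun x hx => ?_
        rw [sum_monicsOfDegree_filter_dvd χ ψ (mem_primePowersUpTo.1 hx).1.1]
        split_ifs <;> ring

theorem primePowerSum_one : primePowerSum χ ψ 1 = ∑ y : F, χ y * ψ y := by
  have h := natCast_mul_sum_monicsOfDegree χ ψ 1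
  rw [sum_monicsOfDegree_one] at h
  rw [primePowerSum, ← primePowersUpTo_filter_eq le_rfl, Finset.sum_filter]
  rw [Nat.cast_one, one_mul] at h
  rw [h]
  refine Finset.sum_congr rfl fun x hx => ?_
  have h1 := (mem_primePowersUpTo.1 hx).1.2.2.natDegree_pos
  have h2 := (mem_primePowersUpTo.1 hx).2.1
  have h3 : 1 ≤ x.2 * x.1.natDegree := Nat.mul_pos h2 h1
  by_cases h4 : x.2 * x.1.natDegree = 1
  · simp [h4, sum_monicsOfDegree_zero]
  · rw [if_neg h4, if_neg (by omega)]

/-- In degree n + 1 ≥ 2 the left side of the logarithmic derivative identity vanishes, and on the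
right only cofactors of degree 0 (weight 1) and 1 (weight G) survive. -/
theorem primePowerSum_succ [IsAddTorsionFree R] (hψ : ∑ x, ψ x = 0) {n : ℕ} (hn : 1 ≤ n) :
    primePowerSum χ ψ (n + 1) = -((∑ y : F, χ y * ψ y) * primePowerSum χ ψ n) := by
  have h := natCast_mul_sum_monicsOfDegree χ ψ (n + 1)
  rw [sum_monicsOfDegree_of_two_le χ ψ hψ (by omega), mul_zero] at h
  rw [eq_neg_iff_add_eq_zero, primePowerSum, primePowerSum,
    ← primePowersUpTo_filter_eq (le_refl (n + 1)), ← primePowersUpTo_filter_eq (Nat.le_succ n),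
    Finset.sum_filter, Finset.sum_filter, Finset.mul_sum, ← Finset.sum_add_distrib]
  refine Eq.trans (Finset.sum_congr rfl fun x _ => ?_) h.symm
  rcases lt_trichotomy (x.2 * x.1.natDegree) n with h1 | h1 | h1
  · rw [if_neg (by omega), if_neg (by omega), if_pos (by omega),
      sum_monicsOfDegree_of_two_le χ ψ hψ (by omega)]
    ring
  · rw [if_neg (by omega), if_pos h1, if_pos (by omega), h1, Nat.add_sub_cancel_left,
      sum_monicsOfDegree_one]
    ring
  · by_cases h2 : x.2 * x.1.natDegree = n + 1
    · rw [if_pos h2, if_neg (by omega), if_pos (by omega), h2, Nat.sub_self,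
        sum_monicsOfDegree_zero]
      ring
    · rw [if_neg h2, if_neg (by omega), if_neg (by omega)]
      ring

theorem primePowerSum_eq [IsAddTorsionFree R] (hψ : ∑ x, ψ x = 0) {n : ℕ} (hn : 1 ≤ n) :
    primePowerSum χ ψ n = (-1) ^ (n - 1) * (∑ y : F, χ y * ψ y) ^ n := by
  induction n, hn using Nat.le_induction with
  | base => simp [primePowerSum_one]
  | succ n hn ih =>
    rw [primePowerSum_succ χ ψ hψ hn, ih]
    obtain ⟨n, rfl⟩ := Nat.exists_eq_add_of_le' hn
    simp only [Nat.add_sub_cancel]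
    ring

end Weight

/-! ### The Hasse–Davenport relation -/

section HasseDavenport

open IntermediateField

variable {F : Type*} [Field F] {R : Type*} [CommRing R] (χ : F →* R) (ψ : AddChar F R)
  {K : Type*} [Field K] [Algebra F K]

/-- Norm and trace pass through F(x), where they are coefficients of the minimal polynomial up to
sign; the remaining degree [K : F(x)] becomes the exponent. -/
theorem apply_norm_mul_apply_trace_eq [FiniteDimensional F K] (x : K) :
    χ (Algebra.norm F x) * ψ (Algebra.trace F K x) =
      polyWeight χ ψ (minpoly F x) ^ Module.finrank F⟮x⟯ K := by
  have hx : IsIntegral F x := Algebra.IsIntegral.isIntegral x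
  have h1 := Algebra.PowerBasis.norm_gen_eq_coeff_zero_minpoly (adjoin.powerBasis hx)
  have h2 := PowerBasis.trace_gen_eq_nextCoeff_minpoly (adjoin.powerBasis hx)
  rw [adjoin.powerBasis_gen, minpoly_gen] at h1 h2
  rw [adjoin.powerBasis_dim] at h1
  rw [Algebra.norm_eq_norm_adjoin, trace_eq_trace_adjoin, h1, h2, polyWeight, map_pow,
    AddChar.map_nsmul_eq_pow, mul_pow]

/-- The degree condition makes P divide X^|K| - X, so the separable P splits in K, and its roots are
exactly the elements counted. -/
theorem card_minpoly_eq [Finite F] [Fintype K] {P : F[X]} [DecidableEq F[X]] (hP : P.Monic)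
    (hi : Irreducible P) (hd : P.natDegree ∣ Module.finrank F K) :
    (Finset.univ.filter fun x : K => minpoly F x = P).card = P.natDegree := by
  classical
  have : Fintype F := Fintype.ofFinite F
  have hsep : P.Separable := PerfectField.separable_of_irreducible hi
  have hdvd : P ∣ X ^ Nat.card K - X := by
    rw [Module.natCard_eq_pow_finrank (K := F) (V := K)]
    exact hi.natDegree_dvd_iff_dvd_X_pow_card_pow_sub_X.1 hd
  have hspl : (P.map (algebraMap F K)).Splits := by
    refine (splits_X_pow_nat_card_sub_X (K := K)).of_dvd ?_ ?_
    · exact FiniteField.X_pow_card_sub_X_ne_zero K Finite.one_lt_card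
    · simpa using Polynomial.map_dvd (algebraMap F K) hdvd
  rw [← card_rootSet_eq_natDegree hsep hspl, ← Set.toFinset_card]
  congr 1
  ext x
  simp only [Finset.mem_filter, Finset.mem_univ, true_and, Set.mem_toFinset, mem_rootSet]
  constructor
  · rintro rfl
    exact ⟨hP.ne_zero, minpoly.aeval F x⟩
  · rintro ⟨_, h⟩
    exact (minpoly.eq_of_irreducible_of_monic hi h hP).symm

variable [Fintype F] [Fintype K]

/-- Group the x by (minimal polynomial P, [K : F(x)]): each group has deg P elements with equal
summands. -/
theorem sum_norm_trace_eq_primePowerSum :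
    ∑ x : K, χ (Algebra.norm F x) * ψ (Algebra.trace F K x) =
      primePowerSum χ ψ (Module.finrank F K) := by
  classical
  have hdeg (x : K) : Module.finrank F⟮x⟯ K * (minpoly F x).natDegree = Module.finrank F K := by
    rw [← adjoin.finrank (Algebra.IsIntegral.isIntegral x), mul_comm, Module.finrank_mul_finrank]
  rw [primePowerSum, ← Finset.sum_fiberwise_of_maps_to
    (g := fun x : K => (minpoly F x, Module.finrank F⟮x⟯ K)) (t := primePowersOfDegree F _)]
  · refine Finset.sum_congr rfl fun p hp => ?_
    obtain ⟨P, k⟩ := p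
    obtain ⟨h1, h2, h3, h4⟩ := mem_primePowersOfDegree.1 hp
    dsimp only at h1 h2 h3 h4 ⊢
    have hfil : (Finset.univ.filter fun x : K => (minpoly F x, Module.finrank F⟮x⟯ K) = (P, k)) =
        Finset.univ.filter fun x : K => minpoly F x = P := by
      ext x
      simp only [Finset.mem_filter, Finset.mem_univ, true_and, Prod.mk.injEq, and_iff_left_iff_imp]
      intro hx
      have := hdeg x
      rw [hx, ← h4] at this
      exact Nat.eq_of_mul_eq_mul_right h2.natDegree_pos this
    rw [← card_minpoly_eq (K := K) h1 h2 ⟨k, by rw [← h4, mul_comm]⟩, ← hfil, ← nsmul_eq_mul]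
    refine Finset.sum_eq_card_nsmul fun x hx => ?_
    simp only [Finset.mem_filter, Prod.mk.injEq] at hx
    rw [apply_norm_mul_apply_trace_eq, hx.2.1, hx.2.2]
  · intro x _
    have hx : IsIntegral F x := Algebra.IsIntegral.isIntegral x
    exact mem_primePowersOfDegree.2
      ⟨minpoly.monic hx, minpoly.irreducible hx, Module.finrank_pos, hdeg x⟩

/-- The Hasse–Davenport lifting relation. -/
theorem sum_norm_trace_eq [IsAddTorsionFree R] (hψ : ∑ x, ψ x = 0) :
    ∑ x : K, χ (Algebra.norm F x) * ψ (Algebra.trace F K x) =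
      (-1) ^ (Module.finrank F K - 1) * (∑ y : F, χ y * ψ y) ^ Module.finrank F K := by
  rw [sum_norm_trace_eq_primePowerSum, primePowerSum_eq χ ψ hψ Module.finrank_pos]

end HasseDavenport

end SemisimpleNormTrace

namespace SemisimpleNormTrace

/-! ### Gauss sums of semisimple algebras -/

section SemisimpleAlgebra

variable {F : Type*} [Field F] {B : Type*} [Ring B] [Algebra F B]
  {k : ℕ} {d : Fin k → ℕ} {K : Fin k → Type*} [∀ i, Field (K i)] [∀ i, Algebra F (K i)]
  (e : B ≃ₐ[F] ((i : Fin k) → Matrix (Fin (d i)) (Fin (d i)) (K i)))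

/-- The reduced norm as a homomorphism of monoids. -/
noncomputable def redNormHom : B →* F where
  toFun := redNorm e
  map_one' := by simp [redNorm]
  map_mul' x y := by simp [redNorm, Finset.prod_mul_distrib]

@[simp]
theorem redNormHom_apply (x : B) : redNormHom e x = redNorm e x := rfl

/-- Allows sums over units of norm b ≠ 0 to be replaced by sums over all of B. -/
theorem isUnit_of_redNorm_ne_zero [∀ i, FiniteDimensional F (K i)] {x : B}
    (hx : redNorm e x ≠ 0) : IsUnit x := by
  rw [← MulEquiv.isUnit_map e, Pi.isUnit_iff]
  intro i
  rw [Matrix.isUnit_iff_isUnit_det, isUnit_iff_ne_zero, ← Algebra.norm_ne_zero_iff (R := F)]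
  exact Finset.prod_ne_zero_iff.1 hx i (Finset.mem_univ i)

theorem exists_redNorm_eq [∀ i, Finite (K i)] (i₀ : Fin k) (hd : 1 ≤ d i₀) (b : F) :
    ∃ x : B, redNorm e x = b := by
  classical
  obtain ⟨y, hy⟩ := FiniteField.norm_surjective F (K i₀) b
  let M : Matrix (Fin (d i₀)) (Fin (d i₀)) (K i₀) :=
    Matrix.diagonal (Function.update 1 ⟨0, hd⟩ y)
  have hM : M.det = y := by
    simp [M, Matrix.det_diagonal, Finset.prod_update_of_mem]
  refine ⟨e.symm (Function.update 1 i₀ M), ?_⟩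
  rw [redNorm, AlgEquiv.apply_symm_apply, Finset.prod_eq_single i₀]
  · simp [hM, hy]
  · intro i _ hi
    simp [Function.update_of_ne hi]
  · simp

theorem addChar_map_sum {A R ι : Type*} [AddCommMonoid A] [CommMonoid R] (ψ : AddChar A R)
    (s : Finset ι) (f : ι → A) : ψ (∑ i ∈ s, f i) = ∏ i ∈ s, ψ (f i) :=
  map_prod ψ.toMonoidHom (fun i => Multiplicative.ofAdd (f i)) s

/-- The constant `∏ᵢ (-1)^{(nᵢ-1)dᵢ} q^{nᵢdᵢ(dᵢ-1)/2}` relating the Gauss sums of `B` and of the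
split algebra of degree `∑ᵢ dᵢnᵢ`. -/
noncomputable def gaussConst (F : Type*) [Field F] {k : ℕ} (d : Fin k → ℕ) (K : Fin k → Type*)
    [∀ i, Field (K i)] [∀ i, Algebra F (K i)] : ℤ :=
  (-1) ^ (∑ i, (Module.finrank F (K i) - 1) * d i) *
    (Nat.card F : ℤ) ^ (∑ i, Module.finrank F (K i) * (d i * (d i - 1) / 2))

theorem sum_redNorm_redTrace [Fintype F] [∀ i, Finite (K i)] [Fintype B] {R : Type*} [CommRing R]
    [IsAddTorsionFree R] (χ : F →* R) {ψ : AddChar F R} (hψ : ∑ x, ψ x = 0) :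
    ∑ x : B, χ (redNorm e x) * ψ (redTrace e x) =
      (gaussConst F d K : R) * (∑ y, χ y * ψ y) ^ (∑ i, d i * Module.finrank F (K i)) := by
  classical
  have (i : Fin k) : Fintype (K i) := Fintype.ofFinite _
  have hψK (i : Fin k) : ∑ x : K i, ψ (Algebra.trace F (K i) x) = 0 :=
    sum_comp_surjective_eq_zero (Algebra.trace F (K i)).toAddMonoidHom
      (Algebra.trace_surjective F (K i)) ψ hψ
  have hfactor (i : Fin k) : ∑ X : Matrix (Fin (d i)) (Fin (d i)) (K i),
      χ (Algebra.norm F X.det) * ψ (Algebra.trace F (K i) X.trace) =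
      (-1) ^ ((Module.finrank F (K i) - 1) * d i) *
        (Nat.card F : R) ^ (Module.finrank F (K i) * (d i * (d i - 1) / 2)) *
        (∑ y, χ y * ψ y) ^ (d i * Module.finrank F (K i)) := by
    -- The matrix formula is applied over K i to χ ∘ N and ψ ∘ Tr; Hasse–Davenport then brings the
    -- Gauss sum down to F.
    have h := matrixGaussSum_fin (χ.comp (Algebra.norm F (S := K i)))
      (ψ := ψ.compAddMonoidHom (Algebra.trace F (K i)).toAddMonoidHom) (hψK i) (d i)
    refine h.trans ?_
    have h2 := sum_norm_trace_eq χ ψ (K := K i) hψ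
    simp only [MonoidHom.comp_apply, AddChar.compAddMonoidHom_apply, LinearMap.toAddMonoidHom_coe]
    rw [h2, Module.card_eq_pow_finrank (K := F) (V := K i), Nat.card_eq_fintype_card]
    push_cast
    ring
  calc ∑ x : B, χ (redNorm e x) * ψ (redTrace e x)
      = ∑ x : (i : Fin k) → Matrix (Fin (d i)) (Fin (d i)) (K i),
          ∏ i, χ (Algebra.norm F (x i).det) * ψ (Algebra.trace F (K i) (x i).trace) := by
        refine Fintype.sum_equiv e.toEquiv _ _ fun x => ?_
        rw [Finset.prod_mul_distrib, redNorm, redTrace, map_prod, addChar_map_sum]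
        rfl
    _ = ∏ i, ∑ X : Matrix (Fin (d i)) (Fin (d i)) (K i),
          χ (Algebra.norm F X.det) * ψ (Algebra.trace F (K i) X.trace) :=
        (Fintype.prod_sum fun i (X : Matrix (Fin (d i)) (Fin (d i)) (K i)) =>
          χ (Algebra.norm F X.det) * ψ (Algebra.trace F (K i) X.trace)).symm
    _ = _ := by
        rw [Finset.prod_congr rfl fun i _ => hfactor i, Finset.prod_mul_distrib,
          Finset.prod_mul_distrib, Finset.prod_pow_eq_pow_sum, Finset.prod_pow_eq_pow_sum,
          Finset.prod_pow_eq_pow_sum, gaussConst]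
        push_cast
        rfl

end SemisimpleAlgebra

/-! ### Fourier inversion on norm fibres -/

section Fourier

theorem isAddTorsionFree_monoidAlgebra (S M : Type*) [Semiring S] [IsAddTorsionFree S] :
    IsAddTorsionFree (MonoidAlgebra S M) where
  nsmul_right_injective n hn x y h := by
    ext m
    have := congrArg (fun z : MonoidAlgebra S M => z.coeff m) h
    exact nsmul_right_injective hn (by simpa using this)

variable {F : Type*} [Field F] {B : Type*} [Ring B] [Algebra F B]
  {k : ℕ} {d : Fin k → ℕ} {K : Fin k → Type*} [∀ i, Field (K i)] [∀ i, Algebra F (K i)]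
  (e : B ≃ₐ[F] ((i : Fin k) → Matrix (Fin (d i)) (Fin (d i)) (K i)))

open scoped Classical in
/-- The sum of `ψ(Tr u)` over the units `u` of norm `b`. -/
noncomputable def normFiberSum [Fintype Bˣ] (ψ : AddChar F ℂ) (b : F) : ℂ :=
  ∑ u ∈ Finset.univ.filter fun u : Bˣ => redNorm e (u : B) = b, ψ (redTrace e (u : B))

theorem normFiberSum_eq_coeff [Fintype B] [Fintype Bˣ] [∀ i, FiniteDimensional F (K i)]
    (ψ : AddChar F ℂ) {b : F} (hb : b ≠ 0) :
    normFiberSum e ψ b = (∑ x : B, MonoidAlgebra.of ℂ F (redNorm e x) *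
      algebraMap ℂ (MonoidAlgebra ℂ F) (ψ (redTrace e x))).coeff b := by
  classical
  have h (x : B) : (MonoidAlgebra.of ℂ F (redNorm e x) *
      algebraMap ℂ (MonoidAlgebra ℂ F) (ψ (redTrace e x))).coeff b =
      if redNorm e x = b then ψ (redTrace e x) else 0 := by
    simp [MonoidAlgebra.single_mul_single, Finsupp.single_apply]
  rw [MonoidAlgebra.coeff_sum, Finsupp.finsetSum_apply]
  simp_rw [h]
  rw [← Finset.sum_filter, normFiberSum]
  refine Finset.sum_bij (fun u _ => (u : B)) ?_ ?_ ?_ ?_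
  · simp
  · intro u _ v _ h
    exact Units.ext h
  · intro x hx
    simp only [Finset.mem_filter, Finset.mem_univ, true_and] at hx
    obtain ⟨u, rfl⟩ := isUnit_of_redNorm_ne_zero e (by rwa [hx])
    exact ⟨u, by simpa using hx, rfl⟩
  · simp

variable [Fintype F]

/-- Orthogonality of additive characters isolates the units of trace a. -/
theorem natCard_mul_normTraceCount [Fintype Bˣ] (a b : F) :
    (Nat.card F : ℂ) * normTraceCount e a b = ∑ ψ : AddChar F ℂ, ψ (-a) * normFiberSum e ψ b := by
  classical
  simp_rw [normFiberSum, Finset.mul_sum]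
  rw [Finset.sum_comm]
  have h (u : Bˣ) : ∑ ψ : AddChar F ℂ, ψ (-a) * ψ (redTrace e (u : B)) =
      if redTrace e (u : B) = a then (Nat.card F : ℂ) else 0 := by
    simp_rw [← AddChar.map_add_eq_mul]
    rw [AddChar.sum_apply_eq_ite, Nat.card_eq_fintype_card]
    simp only [neg_add_eq_zero, eq_comm (a := a)]
  simp_rw [h]
  rw [← Finset.sum_filter, Finset.filter_filter, Finset.sum_const, normTraceCount,
    Nat.card_eq_fintype_card (α := { u : Bˣ // _ }), Fintype.card_subtype, nsmul_eq_mul, mul_comm]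
  simp_rw [and_comm]

/-- The fibres of a surjective homomorphism B^* → F^* all have the same size. -/
theorem normFiberSum_one [Fintype Bˣ] (hsurj : ∀ b : F, b ≠ 0 → ∃ u : Bˣ, redNorm e (u : B) = b)
    {b : F} (hb : b ≠ 0) :
    ((Nat.card F : ℂ) - 1) * normFiberSum e 1 b = Nat.card Bˣ := by
  classical
  let f : Bˣ →* Fˣ := Units.map (redNormHom e)
  have hf : Function.Surjective f := fun c => by
    obtain ⟨u, hu⟩ := hsurj c c.ne_zero
    exact ⟨u, Units.ext hu⟩
  have hfib (c : Fˣ) : (Finset.univ.filter fun u => f u = c).card =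
      (Finset.univ.filter fun u => f u = Units.mk0 b hb).card :=
    MonoidHom.card_fiber_eq_of_mem_range f (hf c) (hf _)
  have hcard : Fintype.card Bˣ =
      Fintype.card Fˣ * (Finset.univ.filter fun u => f u = Units.mk0 b hb).card := by
    rw [← Finset.card_univ, Finset.card_eq_sum_card_fiberwise (f := f) (t := Finset.univ) (by simp),
      Finset.sum_congr rfl fun c _ => hfib c]
    simp
  have hset : (Finset.univ.filter fun u => f u = Units.mk0 b hb) =
      Finset.univ.filter fun u : Bˣ => redNorm e (u : B) = b := by
    ext u
    simp [f, Units.ext_iff]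
  have hq : (Fintype.card Fˣ : ℂ) = (Nat.card F : ℂ) - 1 := by
    rw [← Nat.card_eq_fintype_card, Nat.card_units, Nat.cast_sub Nat.card_pos, Nat.cast_one]
  rw [Nat.card_eq_fintype_card (α := Bˣ), hcard, Nat.cast_mul, hq, hset, normFiberSum]
  simp

end Fourier

/-! ### Comparison with the split algebra -/

section Comparison

variable {F : Type*} [Field F] [Finite F] {B : Type*} [Ring B] [Algebra F B]
  {k : ℕ} {d : Fin k → ℕ} {K : Fin k → Type*} [∀ i, Field (K i)] [∀ i, Algebra F (K i)]
  [∀ i, Finite (K i)]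
  (e : B ≃ₐ[F] ((i : Fin k) → Matrix (Fin (d i)) (Fin (d i)) (K i)))

theorem normFiberSum_eq_mul_split [Fintype Bˣ] {m : ℕ} [Fintype (Fin m → F)ˣ]
    (hm : m = ∑ i, d i * Module.finrank F (K i)) {ψ : AddChar F ℂ} (hψ : ψ ≠ 1) {b : F}
    (hb : b ≠ 0) :
    normFiberSum e ψ b = gaussConst F d K * normFiberSum (splitEquiv F m) ψ b := by
  classical
  have := Fintype.ofFinite F
  have : Finite B := Finite.of_equiv _ e.symm.toEquiv
  have := Fintype.ofFinite B
  have := isAddTorsionFree_monoidAlgebra ℂ F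
  let ψ' : AddChar F (MonoidAlgebra ℂ F) :=
    (algebraMap ℂ (MonoidAlgebra ℂ F)).toMonoidHom.compAddChar ψ
  have hψ' : ∑ x, ψ' x = 0 := by
    change ∑ x, algebraMap ℂ (MonoidAlgebra ℂ F) (ψ x) = 0
    rw [← map_sum, AddChar.sum_eq_zero_of_ne_one hψ, map_zero]
  have h1 := sum_redNorm_redTrace e (MonoidAlgebra.of ℂ F) hψ'
  have h2 := sum_redNorm_redTrace (splitEquiv F m) (MonoidAlgebra.of ℂ F) hψ'
  have hc : gaussConst F (fun _ : Fin m => 1) (fun _ => F) = 1 := by simp [gaussConst]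
  have hexp : ∑ i : Fin m, (fun _ => 1 : Fin m → ℕ) i * Module.finrank F F = m := by simp
  rw [hc, hexp, Int.cast_one, one_mul] at h2
  rw [← hm, ← h2, ← zsmul_eq_mul] at h1
  rw [normFiberSum_eq_coeff e ψ hb, normFiberSum_eq_coeff (splitEquiv F m) ψ hb]
  have h3 := congrArg (fun z : MonoidAlgebra ℂ F => z.coeff b) h1
  rw [MonoidAlgebra.coeff_smul, Finsupp.smul_apply, zsmul_eq_mul] at h3
  exact h3

/-- Up to main terms, the norm-trace count of `B` is `gaussConst F d K` times that of the split
algebra. -/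
theorem normTraceCount_sub_eq {m : ℕ} (hm : m = ∑ i, d i * Module.finrank F (K i)) (hm0 : 1 ≤ m)
    (i₀ : Fin k) (hd : 1 ≤ d i₀) (a : F) {b : F} (hb : b ≠ 0) :
    (Nat.card F : ℂ) * normTraceCount e a b - Nat.card Bˣ / ((Nat.card F : ℂ) - 1) =
      gaussConst F d K * ((Nat.card F : ℂ) * normTraceCount (splitEquiv F m) a b -
        ((Nat.card F : ℂ) - 1) ^ m / ((Nat.card F : ℂ) - 1)) := by
  classical
  have := Fintype.ofFinite F
  have : Finite B := Finite.of_equiv _ e.symm.toEquiv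
  have := Fintype.ofFinite Bˣ
  have := Fintype.ofFinite (Fin m → F)ˣ
  have hq : (Nat.card F : ℂ) - 1 ≠ 0 := by
    rw [sub_ne_zero]
    exact_mod_cast (Finite.one_lt_card (α := F)).ne'
  have hB := normFiberSum_one e (fun c hc => by
    obtain ⟨x, hx⟩ := exists_redNorm_eq e i₀ hd c
    obtain ⟨u, rfl⟩ := isUnit_of_redNorm_ne_zero e (by rwa [hx])
    exact ⟨u, hx⟩) hb
  have hS := normFiberSum_one (splitEquiv F m) (fun c hc => by
    obtain ⟨x, hx⟩ := exists_redNorm_eq (splitEquiv F m) ⟨0, hm0⟩ le_rfl c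
    obtain ⟨u, rfl⟩ := isUnit_of_redNorm_ne_zero (splitEquiv F m) (by rwa [hx])
    exact ⟨u, hx⟩) hb
  have hcard : (Nat.card (Fin m → F)ˣ : ℂ) = ((Nat.card F : ℂ) - 1) ^ m := by
    rw [Nat.card_congr MulEquiv.piUnits.toEquiv, Nat.card_fun, Nat.card_units, Nat.cast_pow,
      Nat.cast_sub Nat.card_pos]
    simp
  -- The subtracted main terms are exactly the contributions of ψ = 1, so only nontrivial ψ remain.
  rw [natCard_mul_normTraceCount, natCard_mul_normTraceCount, ← hcard, ← hB, ← hS,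
    mul_div_cancel_left₀ _ hq, mul_div_cancel_left₀ _ hq,
    ← Finset.add_sum_erase _ _ (Finset.mem_univ (1 : AddChar F ℂ)),
    ← Finset.add_sum_erase _ (fun ψ : AddChar F ℂ => ψ (-a) * normFiberSum (splitEquiv F m) ψ b)
      (Finset.mem_univ (1 : AddChar F ℂ))]
  simp only [AddChar.one_apply, one_mul, add_sub_cancel_left, Finset.mul_sum]
  refine Finset.sum_congr rfl fun ψ hψ => ?_
  rw [normFiberSum_eq_mul_split e hm (Finset.ne_of_mem_erase hψ) hb]
  ring

end Comparison

end SemisimpleNormTrace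

/-! ### Exponents, signs and the final identity -/

theorem lemma1p2 {F : Type*} [Field F] [Finite F] {B : Type*} [Ring B] [Algebra F B]
    {k : ℕ} {d : Fin k → ℕ} (hd : ∀ i, 1 ≤ d i)
    {K : Fin k → Type*} [∀ i, Field (K i)] [∀ i, Algebra F (K i)] [∀ i, Finite (K i)]
    (e : B ≃ₐ[F] ((i : Fin k) → Matrix (Fin (d i)) (Fin (d i)) (K i)))
    (q n m : ℕ) (hq : q = Nat.card F)
    (hn : n = ∑ i, d i ^ 2 * Module.finrank F (K i))
    (hm : m = ∑ i, d i * Module.finrank F (K i))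
    (hn2 : 2 ≤ n) (a b : F) (hb : b ≠ 0) :
    (SemisimpleNormTrace.normTraceCount e a b : ℝ)
        - ((Nat.card Bˣ : ℝ) / ((q : ℝ) * ((q : ℝ) - 1))
          + (-1 : ℝ) ^ (∑ i, d i) * (q : ℝ) ^ (((n : ℝ) - (m : ℝ)) / 2) / (q : ℝ))
      = (-1 : ℝ) ^ ((m : ℤ) - ∑ i, (d i : ℤ)) * (q : ℝ) ^ (((n : ℝ) - (m : ℝ)) / 2)
        * ((SemisimpleNormTrace.normTraceCount (SemisimpleNormTrace.splitEquiv F m) a b : ℝ)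
          - (((q : ℝ) - 1) ^ (m - 1) + (-1 : ℝ) ^ m) / (q : ℝ)) := by
  have hpos (i : Fin k) : 1 ≤ Module.finrank F (K i) := Module.finrank_pos
  -- The zero algebra is excluded by n ≥ 2; a factor is needed for the norm to be surjective and for
  -- m ≥ 1.
  obtain ⟨i₀⟩ : Nonempty (Fin k) := by
    by_contra h
    rw [not_nonempty_iff] at h
    simp at hn
    omega
  have hm0 : 1 ≤ m := by
    rw [hm]
    exact (Nat.mul_pos (hd i₀) (hpos i₀)).trans_le
      (Finset.single_le_sum (f := fun i => d i * Module.finrank F (K i)) (by simp)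
        (Finset.mem_univ i₀))
  have hq1 : 1 < q := hq ▸ Finite.one_lt_card
  have hq0 : (q : ℝ) ≠ 0 := by positivity
  have hq1' : (q : ℝ) - 1 ≠ 0 := by
    rw [sub_ne_zero]
    exact_mod_cast hq1.ne'
  set D := ∑ i, d i with hD
  set E := ∑ i, (Module.finrank F (K i) - 1) * d i with hE
  set T := ∑ i, Module.finrank F (K i) * (d i * (d i - 1) / 2) with hT
  have hmE : m = E + D := by
    rw [hm, hE, hD, ← Finset.sum_add_distrib]
    refine Finset.sum_congr rfl fun i _ => ?_
    obtain ⟨r, hr⟩ := Nat.exists_eq_add_of_le' (hpos i)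
    rw [hr, Nat.add_sub_cancel]
    ring
  have hnT : n = m + 2 * T := by
    rw [hn, hm, hT, Finset.mul_sum, ← Finset.sum_add_distrib]
    refine Finset.sum_congr rfl fun i _ => ?_
    have h2 : 2 * (d i * (d i - 1) / 2) = d i * (d i - 1) :=
      Nat.mul_div_cancel' (Nat.even_mul_pred_self (d i)).two_dvd
    rw [mul_left_comm, h2]
    obtain ⟨r, hr⟩ := Nat.exists_eq_add_of_le' (hd i)
    rw [hr, Nat.add_sub_cancel]
    ring
  have hrpow : (q : ℝ) ^ (((n : ℝ) - (m : ℝ)) / 2) = (q : ℝ) ^ T := by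
    rw [← Real.rpow_natCast, hnT]
    congr 1
    push_cast
    ring
  have hzpow : (-1 : ℝ) ^ ((m : ℤ) - ∑ i, (d i : ℤ)) = (-1) ^ E := by
    have : (m : ℤ) - ∑ i, (d i : ℤ) = (E : ℤ) := by
      rw [hmE, hD]
      push_cast
      ring
    rw [this, zpow_natCast]
  have key : (q : ℝ) * SemisimpleNormTrace.normTraceCount e a b - Nat.card Bˣ / ((q : ℝ) - 1) =
      (-1) ^ E * (q : ℝ) ^ T *
        ((q : ℝ) * SemisimpleNormTrace.normTraceCount (SemisimpleNormTrace.splitEquiv F m) a b -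
          ((q : ℝ) - 1) ^ m / ((q : ℝ) - 1)) := by
    have h := SemisimpleNormTrace.normTraceCount_sub_eq e hm hm0 i₀ (hd i₀) a hb
    rw [SemisimpleNormTrace.gaussConst, ← hE, ← hT, ← hq] at h
    exact_mod_cast h
  -- This makes the correction terms (-1)^D q^T / q and (-1)^m / q on the two sides balance.
  have hsign : (-1 : ℝ) ^ D = (-1) ^ E * (-1) ^ m := by
    rw [hmE, pow_add, ← mul_assoc, ← mul_pow]
    simp
  have hpow : ((q : ℝ) - 1) ^ m / ((q : ℝ) - 1) = ((q : ℝ) - 1) ^ (m - 1) := by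
    rw [div_eq_iff hq1', ← pow_succ, Nat.sub_add_cancel hm0]
  rw [hpow] at key
  rw [hrpow, hzpow, hsign]
  refine mul_left_cancel₀ hq0 ?_
  calc _ = ((q : ℝ) * SemisimpleNormTrace.normTraceCount e a b - Nat.card Bˣ / ((q : ℝ) - 1)) -
        (-1) ^ E * (-1) ^ m * (q : ℝ) ^ T := by
        field_simp
        ring
    _ = _ := by
        rw [key]
        field_simp
        ring
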